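/- Let $K$ be a number field with ring of integers $\mathcal{O}_K$, and let $K_{\mathbb{R}}=K\otimes_{\mathbb{Q}}\mathbb{R}\cong\mathbb{R}^{r_1}\times\mathbb{C}^{r_2}$, equipped with Lebesgue measure normalized so that $\mathcal{O}_K$ has covolume $1$; spaces of matrices over $K_{\mathbb{R}}$ carry the product measure. For $D\in M_{m\times n}(K)$ let $\mathfrak{D}(D)$ be the index of $\{C\in M_{1\times m}(\mathcal{O}_K) : C D\in M_{1\times n}(\mathcal{O}_K)\}$ in $M_{1\times m}(\mathcal{O}_K)$. Let $n\ge 0$ and $t\ge n+1$ be integers, and let $g:M_{t\times n}(K_{\mathbb{R}})\to\mathbb{R}$ be the indicator function of a convex compact set. Then the right-hand side of the higher moment formula, $$\sum_{m=0}^{n}\ \sum_{\substack{D\in M_{m\times n}(K)\\ \operatorname{rank}(D)=m\\ D\text{ in reduced row echelon form}}}\mathfrak{D}(D)^{-t}\int_{M_{t\times m}(K_{\mathbb{R}})}g(xD)\,dx ,$$ where the term at $m=0$ is $g(0)$, converges: every index $\mathfrak{D}(D)$ is finite, every integral exists and is finite, and the series of non-negative terms over all pairs $(m,D)$ has a finite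 sum. -/

import Mathlib

open NumberField MeasureTheory

noncomputable section

open scoped Classical in
/-- The Lebesgue measure on `K_ℝ = K ⊗_ℚ ℝ`, identified with `ℝ^{r₁} × ℂ^{r₂}`, that belongs to a
positive multiple of the quadratic form `Tr(x x̄)` and is normalized so that the ring of integers
has covolume one. -/
def unimodularMeasure (K : Type*) [Field K] [NumberField K] : Measure (mixedEmbedding.mixedSpace K) :=
  ENNReal.ofReal (ZLattice.covolume (mixedEmbedding.integerLattice K))⁻¹ • volume

open scoped Classical in
instance instIsAddHaarMeasureUnimodular (K : Type*) [Field K] [NumberField K] :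
    (unimodularMeasure K).IsAddHaarMeasure :=
  Measure.IsAddHaarMeasure.smul _
    (by simpa using ZLattice.covolume_pos (mixedEmbedding.integerLattice K)) ENNReal.ofReal_ne_top

open scoped Classical in
/-- The ring of integers has covolume one for `unimodularMeasure`. -/
theorem covolume_unimodularMeasure (K : Type*) [Field K] [NumberField K] :
    ZLattice.covolume (mixedEmbedding.integerLattice K) (unimodularMeasure K) = 1 := by
  have hpos := ZLattice.covolume_pos (mixedEmbedding.integerLattice K)
  rw [ZLattice.covolume_eq_measure_fundamentalDomain _ _
    ((mixedEmbedding.fundamentalDomain_integerLattice K).mono ?_),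
    unimodularMeasure, measureReal_ennreal_smul_apply,
    ← ZLattice.covolume_eq_measure_fundamentalDomain _ _
      (mixedEmbedding.fundamentalDomain_integerLattice K),
    ENNReal.toReal_ofReal (inv_nonneg.2 hpos.le), inv_mul_cancel₀ hpos.ne']
  exact Measure.smul_absolutelyContinuous

open scoped Classical in
/-- The value of the normalizing constant: `unimodularMeasure` is
`2 ^ r₂ / √|Δ_K|` times the standard Lebesgue measure of `ℝ^{r₁} × ℂ^{r₂}`. -/
theorem unimodularMeasure_eq (K : Type*) [Field K] [NumberField K] :
    unimodularMeasure K =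
      ENNReal.ofReal (2 ^ InfinitePlace.nrComplexPlaces K / √|(discr K : ℝ)|) • volume := by
  rw [unimodularMeasure, mixedEmbedding.covolume_integerLattice]
  congr 2
  rw [mul_inv, inv_pow, inv_inv, div_eq_mul_inv]

/-- The measure on the space of `t × m` matrices over `K_ℝ`: the product of `t * m` copies of
`unimodularMeasure`. -/
def matrixMeasure (K : Type*) [Field K] [NumberField K] (t m : ℕ) :
    Measure (Fin t → Fin m → mixedEmbedding.mixedSpace K) :=
  Measure.pi fun _ => Measure.pi fun _ => unimodularMeasure K

/-- The subgroup of those `C ∈ M_{1 × m}(𝓞 K)` for which `C · D` has entries in `𝓞 K`. -/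
def integralRows {K : Type*} [Field K] {m n : ℕ} (D : Matrix (Fin m) (Fin n) K) :
    AddSubgroup (Fin m → 𝓞 K) where
  carrier := {C | ∀ j, Matrix.vecMul (fun i => (C i : K)) D j ∈ (algebraMap (𝓞 K) K).range}
  zero_mem' j := by
    refine ⟨0, ?_⟩
    simp [Matrix.vecMul, dotProduct]
  add_mem' {a b} ha hb j := by
    have h := add_mem (ha j) (hb j)
    simpa [Matrix.vecMul, dotProduct, add_mul, Finset.sum_add_distrib] using h
  neg_mem' {a} ha j := by
    have h := neg_mem (ha j)
    simpa [Matrix.vecMul, dotProduct, Finset.sum_neg_distrib] using h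

/-- `𝔇(D)`: the index of `{C ∈ M_{1 × m}(𝓞 K) | C · D ∈ M_{1 × n}(𝓞 K)}` in `M_{1 × m}(𝓞 K)`. -/
def denominatorIndex {K : Type*} [Field K] {m n : ℕ} (D : Matrix (Fin m) (Fin n) K) : ℕ :=
  (integralRows D).index

/-- The function `x ↦ g (x D)` on `M_{t × m}(K_ℝ)`, where `D ∈ M_{m × n}(K)` acts through the
embedding of `K` into `K_ℝ`. -/
def pullbackAlong {K : Type*} [Field K] [NumberField K] {t m n : ℕ}
    (g : Matrix (Fin t) (Fin n) (mixedEmbedding.mixedSpace K) → ℝ)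
    (D : Matrix (Fin m) (Fin n) K) (x : Fin t → Fin m → mixedEmbedding.mixedSpace K) : ℝ :=
  g (Matrix.of x * D.map (mixedEmbedding K))

/-- The term `𝔇(D)^{-t} ∫_{x ∈ M_{t × m}(K_ℝ)} g (x D) dx` of the integral formula. -/
def momentTerm {K : Type*} [Field K] [NumberField K] {t m n : ℕ}
    (g : Matrix (Fin t) (Fin n) (mixedEmbedding.mixedSpace K) → ℝ)
    (D : Matrix (Fin m) (Fin n) K) : ℝ :=
  ((denominatorIndex D : ℝ) ^ t)⁻¹ * ∫ x, pullbackAlong g D x ∂(matrixMeasure K t m)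

/-- The `m × n` matrices over `K` in reduced row echelon form and of rank `m`. -/
abbrev FullRankEchelon (K : Type*) [Field K] (m n : ℕ) : Type _ :=
  {D : Matrix (Fin m) (Fin n) K // D.IsReducedRowEchelon ∧ D.rank = m}

/-- For `m = 0` the term of the integral formula is `g 0`. -/
theorem momentTerm_zero {K : Type*} [Field K] [NumberField K] {t n : ℕ}
    (g : Matrix (Fin t) (Fin n) (mixedEmbedding.mixedSpace K) → ℝ)
    (D : Matrix (Fin 0) (Fin n) K) : momentTerm g D = g 0 := by
  have h1 : denominatorIndex D = 1 := by
    have : integralRows D = ⊤ := by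
      ext C
      rw [Subsingleton.elim C 0]
      exact iff_of_true (zero_mem _) (AddSubgroup.mem_top _)
    rw [denominatorIndex, this, AddSubgroup.index_top]
  have h2 : pullbackAlong g D = fun _ => g 0 := by
    funext x
    rw [pullbackAlong]
    congr 1
  have h3 : matrixMeasure K t 0 Set.univ = 1 := by
    have : SigmaFinite (unimodularMeasure K) := inferInstance
    have : SigmaFinite (Measure.pi fun _ : Fin 0 => unimodularMeasure K) := inferInstance
    rw [matrixMeasure, Measure.pi_univ]
    simp
  rw [momentTerm, h1, h2, integral_const, measureReal_def, h3]
  simp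

end

/-!
For a reduced row echelon matrix `D` of rank `m`, write `Λ` for the lattice of the vectors `C D`
with `C ∈ integralRows D`; these are the integral points of the row space of `D`. The term of `D`
is at most the `t`-th power of `vol {y | ‖y D‖ ≤ R} / 𝔇(D)`, where `R` bounds the rows of the
matrices in `S`: this is the volume of a ball in the row space of `D`, divided by the covolume
of `Λ`.

A weak form of Minkowski's second theorem, for successive minima taken over `K`, bounds this
quotient. Choose `v₁, …, v_m ∈ integralRows D` greedily, each with `v_i D` as short as possible
among those independent over `K` of the preceding ones (`exists_linearIndependent_successive_min`),
and let `d = [K : ℚ]`. The vectors `ω_j v_i`, with `ω_j` a rational basis of `K`, form a real basis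
of `K_ℝ ^ m` (`exists_basis_of_linearIndependent`). Orthonormalize it for the inner product pulled
back from the row space and take the box whose sides are the lengths `‖v_i D‖`, each `d` times,
divided by the square root of the dimension. By minimality the translates of this box by
`integralRows D` are disjoint (`exists_packing_box`), so its volume is at most a constant times
`𝔇(D)` (`measure_le_index_mul_of_disjoint_vadd`). Comparison of the ball with the box gives
`vol {y | ‖y D‖ ≤ R} / 𝔇(D) ≤ κ ∏ ‖v_i D‖ ^ (-d)` with `κ` independent of `D`
(`exists_lattice_vectors_measure_le`).

Finally `D` is determined by its pivot columns and the integral vectors `u_i = v_i D`, since the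
matrix `(v_i)` consists of the pivot columns of `(u_i)`. Hence, up to the factor that counts the
choices of pivot columns, the series is dominated by `(∑ ‖u‖ ^ (-d t)) ^ m`, with `u` running
through a lattice of rank `d n`, and this converges because `t > n`.
-/

/-! ### Packing, successive minima and sums over tuples -/

open scoped Pointwise in
/-- A set whose translates by a subgroup `H` of finite index are disjoint has at most `[G : H]`
times the measure of a fundamental domain of `G`: sort the translates by all of `G` into cosets
of `H`. -/
theorem measure_le_index_mul_of_disjoint_vadd {G α : Type*} [AddGroup G] [Countable G]
    [AddAction G α] [MeasurableSpace α] {ν : Measure α} [VAddInvariantMeasure G α ν]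
    [MeasurableConstVAdd G α] {F P : Set α} (hF : IsAddFundamentalDomain G F ν)
    (H : AddSubgroup G) [H.FiniteIndex] (hP : NullMeasurableSet P ν)
    (hdisj : ∀ h ∈ H, h ≠ 0 → Disjoint (h +ᵥ P) P) : ν P ≤ H.index * ν F := by
  have hpair : Pairwise fun h h' : H => Disjoint ((h : G) +ᵥ P) ((h' : G) +ᵥ P) := by
    intro h h' hne
    have := hdisj (-(h' : G) + h) (H.add_mem (H.neg_mem h'.2) h.2) (by
      intro h0
      exact hne (Subtype.ext (neg_add_eq_zero.1 h0).symm))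
    rw [Set.disjoint_left] at this ⊢
    intro x hx hx'
    refine this (a := -(h' : G) +ᵥ x) ?_ (Set.mem_vadd_set_iff_neg_vadd_mem.1 hx')
    rw [← vadd_vadd]
    exact Set.vadd_mem_vadd_set hx
  have hcoset (q : G ⧸ H) : ∑' h : H, ν (((q.out + h : G) +ᵥ P) ∩ F) ≤ ν F := by
    rw [← measure_iUnion₀]
    · exact measure_mono (Set.iUnion_subset fun h => Set.inter_subset_right)
    · intro h h' hne
      refine Disjoint.aedisjoint (Disjoint.mono Set.inter_subset_left Set.inter_subset_left ?_)
      rw [← vadd_vadd, ← vadd_vadd]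
      exact (Set.disjoint_vadd_set).2 (hpair hne)
    · intro h
      exact (hP.vadd _).inter hF.nullMeasurableSet
  have hfin : Finite (G ⧸ H) := inferInstance
  have := Fintype.ofFinite (G ⧸ H)
  calc ν P = ∑' g : G, ν ((g +ᵥ P) ∩ F) := hF.measure_eq_tsum P
    _ ≤ ∑' p : (G ⧸ H) × H, ν (((p.1.out + p.2 : G) +ᵥ P) ∩ F) := by
      refine ENNReal.tsum_le_tsum_comp_of_surjective
        (f := fun p : (G ⧸ H) × H => (p.1.out + p.2 : G)) (fun g => ?_)
        fun g => ν ((g +ᵥ P) ∩ F)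
      obtain ⟨h, hh⟩ := QuotientAddGroup.mk_out_eq_add H g
      exact ⟨((g : G ⧸ H), -h), by simp [hh]⟩
    _ = ∑' q : G ⧸ H, ∑' h : H, ν (((q.out + h : G) +ᵥ P) ∩ F) :=
      ENNReal.tsum_prod (f := fun (q : G ⧸ H) (h : H) => ν (((q.out + h : G) +ᵥ P) ∩ F))
    _ ≤ ∑' _ : G ⧸ H, ν F := ENNReal.tsum_le_tsum hcoset
    _ = H.index * ν F := by
      rw [tsum_fintype, Finset.sum_const, nsmul_eq_mul, Finset.card_univ, AddSubgroup.index,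
        Nat.card_eq_fintype_card]

/-- The box with sides `μ i / √N` in the coordinates obtained by Gram-Schmidt from a basis `b`. If
`x ≠ 0` lies in the span of those `b j` with `μ j ≤ ‖ψ x‖`, then `x` does not translate a point of
the box into the box: its only nonzero coordinates would all be less than `‖ψ x‖ / √N`. The last
clause compares the volume of the box with that of the ball of radius `R`. -/
theorem exists_packing_box {Y E : Type*} [NormedAddCommGroup Y] [NormedSpace ℝ Y]
    [FiniteDimensional ℝ Y] [MeasurableSpace Y] [BorelSpace Y] (ν : Measure Y)
    [ν.IsAddHaarMeasure] [NormedAddCommGroup E] [InnerProductSpace ℝ E]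
    (ψ : Y →ₗ[ℝ] E) (hψ : Function.Injective ψ) {N : ℕ} (b : Module.Basis (Fin N) ℝ Y)
    (μ : Fin N → ℝ) (hpos : ∀ i, 0 < μ i) (hmono : Monotone μ) {R : ℝ} (hR : 0 ≤ R) :
    ∃ P : Set Y, MeasurableSet P ∧
      (∀ x ≠ 0, x ∈ Submodule.span ℝ (b '' {j | μ j ≤ ‖ψ x‖}) → ∀ y ∈ P, x + y ∉ P) ∧
      ν {y | ‖ψ y‖ ≤ R} * ENNReal.ofReal (∏ i, μ i) ≤
        ENNReal.ofReal ((2 * R * √N) ^ N) * ν P := by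
  let e₀ : Y ≃ₗ[ℝ] LinearMap.range ψ := LinearEquiv.ofInjective ψ hψ
  have hcard : Module.finrank ℝ (LinearMap.range ψ) = Fintype.card (Fin N) := by
    rw [← e₀.finrank_eq, Module.finrank_eq_card_basis b]
  let e := InnerProductSpace.gramSchmidtOrthonormalBasis hcard (fun i => e₀ (b i))
  let Φ : Y ≃ₗ[ℝ] (Fin N → ℝ) :=
    e₀.trans (e.repr.toLinearEquiv.trans (WithLp.linearEquiv 2 ℝ (Fin N → ℝ)))
  have hΦ (y : Y) (i : Fin N) : Φ y i = e.repr (e₀ y) i := rfl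
  have hnorm (y : Y) : ‖ψ y‖ ^ 2 = ∑ i, Φ y i ^ 2 := by
    have h1 : ‖ψ y‖ = ‖e.repr (e₀ y)‖ := by
      rw [e.repr.norm_map]; rfl
    rw [h1, EuclideanSpace.norm_sq_eq]
    simp [hΦ]
  -- as `μ` is monotone, `{i | μ i ≤ r}` is an initial segment, which the Gram-Schmidt flag respects
  have htri (x : Y) (r : ℝ) (hx : x ∈ Submodule.span ℝ (b '' {j | μ j ≤ r})) (j : Fin N)
      (hj : r < μ j) : Φ x j = 0 := by
    induction hx using Submodule.span_induction with
    | mem x hx =>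
      obtain ⟨i, hi, rfl⟩ := hx
      have hij : i < j := by
        by_contra h
        exact absurd (hmono (not_lt.1 h)) (not_le.2 (lt_of_le_of_lt hi hj))
      rw [hΦ]
      exact InnerProductSpace.gramSchmidtOrthonormalBasis_inv_triangular' hcard _ hij
    | zero => simp
    | add x y _ _ hx hy => simp [hx, hy]
    | smul a x _ hx => simp [hx]
  -- `Q` is the packing box, and the cube `A` contains the ball
  let Q : Set (Fin N → ℝ) := Set.univ.pi fun i => Set.Ico 0 (μ i / √N)
  let A : Set (Fin N → ℝ) := Set.univ.pi fun _ => Set.Icc (-R) R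
  have hΦc : Continuous Φ := Φ.toLinearMap.continuous_of_finiteDimensional
  -- a Haar measure on `Y` is a multiple of Lebesgue measure in the coordinates `Φ`
  obtain ⟨κ, hκ⟩ : ∃ κ : NNReal, ν.map Φ = κ • (volume : Measure (Fin N → ℝ)) := by
    have : (ν.map Φ).IsAddHaarMeasure := Φ.toContinuousLinearEquiv.isAddHaarMeasure_map ν
    exact ⟨_, Measure.isAddLeftInvariant_eq_smul _ _⟩
  have hpre (s : Set (Fin N → ℝ)) (hs : MeasurableSet s) : ν (Φ ⁻¹' s) = κ * volume s := by
    rw [← Measure.map_apply hΦc.measurable hs, hκ]; rfl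
  have hQm : MeasurableSet Q := MeasurableSet.univ_pi fun _ => measurableSet_Ico
  refine ⟨Φ ⁻¹' Q, hΦc.measurable hQm, ?_, ?_⟩
  · intro x hx0 hx y hy hxy
    have hr : 0 < ‖ψ x‖ := norm_pos_iff.2 fun h => hx0 (hψ (by simpa using h))
    have hNpos : 0 < N := by
      rcases Nat.eq_zero_or_pos N with h | h
      · subst h
        have := hnorm x
        simp at this
        exact absurd this (norm_pos_iff.1 hr)
      · exact h
    have : Nonempty (Fin N) := ⟨⟨0, hNpos⟩⟩
    have hN : (0 : ℝ) < N := by exact_mod_cast hNpos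
    have hcoord (i : Fin N) : Φ x i ^ 2 < ‖ψ x‖ ^ 2 / N := by
      by_cases hi : μ i ≤ ‖ψ x‖
      · have h1 := hy i (Set.mem_univ i)
        have h2 := hxy i (Set.mem_univ i)
        rw [map_add, Pi.add_apply] at h2
        have h3 : |Φ x i| < μ i / √N := by
          rw [abs_lt]; constructor <;> linarith [h1.1, h1.2, h2.1, h2.2]
        have h4 : |Φ x i| < ‖ψ x‖ / √N := h3.trans_le (by gcongr)
        calc Φ x i ^ 2 = |Φ x i| ^ 2 := (sq_abs _).symm
          _ < (‖ψ x‖ / √N) ^ 2 := by gcongr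
          _ = ‖ψ x‖ ^ 2 / N := by rw [div_pow, Real.sq_sqrt hN.le]
      · rw [htri x _ hx i (not_le.1 hi), zero_pow two_ne_zero]
        positivity
    have : ‖ψ x‖ ^ 2 < ∑ _i : Fin N, ‖ψ x‖ ^ 2 / N := by
      rw [hnorm x] at hcoord ⊢
      exact Finset.sum_lt_sum_of_nonempty Finset.univ_nonempty fun i _ => hcoord i
    rw [Finset.sum_const, Finset.card_univ, Fintype.card_fin, nsmul_eq_mul,
      mul_div_cancel₀ _ hN.ne'] at this
    exact lt_irrefl _ this
  · have hsub : {y | ‖ψ y‖ ≤ R} ⊆ Φ ⁻¹' A := by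
      intro y hy i _
      have : |Φ y i| ≤ R := by
        refine abs_le_of_sq_le_sq ?_ hR
        calc Φ y i ^ 2 ≤ ∑ i, Φ y i ^ 2 :=
              Finset.single_le_sum (f := fun i => Φ y i ^ 2) (fun i _ => sq_nonneg _)
                (Finset.mem_univ i)
          _ = ‖ψ y‖ ^ 2 := (hnorm y).symm
          _ ≤ R ^ 2 := by gcongr; exact hy
      exact abs_le.1 this
    have hA : volume A = ENNReal.ofReal ((2 * R) ^ N) := by
      rw [volume_pi_pi]
      simp only [Real.volume_Icc, Finset.prod_const, Finset.card_univ, Fintype.card_fin]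
      rw [← ENNReal.ofReal_pow (by linarith)]
      congr 2; ring
    have hQ : volume Q = ENNReal.ofReal (∏ i, μ i / √N) := by
      rw [volume_pi_pi, ENNReal.ofReal_prod_of_nonneg fun i _ => by have := hpos i; positivity]
      simp only [Real.volume_Ico, sub_zero]
    have hprod : (2 * R) ^ N * ∏ i, μ i = (2 * R * √N) ^ N * ∏ i, μ i / √N := by
      rw [Finset.prod_div_distrib, Finset.prod_const, Finset.card_univ, Fintype.card_fin,
        mul_pow _ (√N)]
      rcases Nat.eq_zero_or_pos N with h | h
      · subst h; simp
      · have : (0 : ℝ) < √N := by positivity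
        field_simp
    calc ν {y | ‖ψ y‖ ≤ R} * ENNReal.ofReal (∏ i, μ i)
        ≤ ν (Φ ⁻¹' A) * ENNReal.ofReal (∏ i, μ i) := by gcongr
      _ = κ * ENNReal.ofReal ((2 * R) ^ N * ∏ i, μ i) := by
          rw [hpre A (MeasurableSet.univ_pi fun _ => measurableSet_Icc), hA, mul_assoc,
            ENNReal.ofReal_mul (by positivity)]
      _ = ENNReal.ofReal ((2 * R * √N) ^ N) * ν (Φ ⁻¹' Q) := by
          rw [hprod, hpre Q hQm, hQ, ENNReal.ofReal_mul (by positivity)]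
          ring

/-- Vectors realizing the successive minima of `ℓ` on `Γ` over the field `F`: every `x ∈ Γ` is a
combination of those that are not longer than `x`. -/
theorem exists_linearIndependent_successive_min {F V : Type*} [Field F] [AddCommGroup V]
    [Module F V] [FiniteDimensional F V] {d : ℕ} (hd : Module.finrank F V = d)
    (Γ : Set V) (hspan : Submodule.span F Γ = ⊤) (ℓ : V → ℝ)
    (hfin : ∀ r, {x ∈ Γ | ℓ x ≤ r}.Finite) :
    ∃ v : Fin d → V, (∀ i, v i ∈ Γ) ∧ LinearIndependent F v ∧
      Monotone (ℓ ∘ v) ∧ ∀ x ∈ Γ, x ∈ Submodule.span F (v '' {j | ℓ (v j) ≤ ℓ x}) := by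
  subst hd
  have key : ∀ k ≤ Module.finrank F V, ∃ v : Fin k → V, (∀ i, v i ∈ Γ) ∧ LinearIndependent F v ∧
      ∀ x ∈ Γ, ∀ i, x ∉ Submodule.span F (v '' Set.Iio i) → ℓ (v i) ≤ ℓ x := by
    intro k
    induction k with
    | zero =>
      exact fun _ => ⟨Fin.elim0, fun i => i.elim0, linearIndependent_empty_type,
        fun _ _ i => i.elim0⟩
    | succ k ih =>
      intro hk
      obtain ⟨v, hvΓ, hv, hmin⟩ := ih (by omega)
      obtain ⟨x₀, hx₀, hx₀'⟩ : ∃ x ∈ Γ, x ∉ Submodule.span F (Set.range v) := by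
        by_contra! h
        have h1 : Submodule.span F (Set.range v) = ⊤ :=
          top_le_iff.1 (hspan ▸ Submodule.span_le.2 h)
        have h2 := finrank_span_eq_card hv
        rw [h1, finrank_top, Fintype.card_fin] at h2
        omega
      obtain ⟨w, ⟨⟨hwΓ, hw⟩, hwx⟩, hwmin⟩ := Set.exists_min_image
        {x | (x ∈ Γ ∧ x ∉ Submodule.span F (Set.range v)) ∧ ℓ x ≤ ℓ x₀} ℓ
        ((hfin (ℓ x₀)).subset fun x hx => ⟨hx.1.1, hx.2⟩) ⟨x₀, ⟨hx₀, hx₀'⟩, le_rfl⟩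
      refine ⟨Fin.snoc v w, ?_, ?_, ?_⟩
      · intro i
        refine Fin.lastCases ?_ (fun i => ?_) i
        · simpa using hwΓ
        · simpa using hvΓ i
      · exact linearIndependent_finSnoc.2 ⟨hv, hw⟩
      · intro x hx i
        refine Fin.lastCases ?_ (fun i => ?_) i
        · intro hxs
          rw [Fin.snoc_last]
          have hxs' : x ∉ Submodule.span F (Set.range v) := by
            refine fun h => hxs (Submodule.span_mono ?_ h)
            rintro _ ⟨j, rfl⟩
            exact ⟨j.castSucc, Fin.castSucc_lt_last j, by simp⟩
          rcases le_total (ℓ x) (ℓ x₀) with h | h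
          · exact hwmin x ⟨⟨hx, hxs'⟩, h⟩
          · exact hwx.trans h
        · intro hxs
          rw [Fin.snoc_castSucc]
          refine hmin x hx i fun h => hxs (Submodule.span_mono ?_ h)
          rintro _ ⟨j, hj, rfl⟩
          exact ⟨j.castSucc, Fin.castSucc_lt_castSucc_iff.2 hj, by simp⟩
  obtain ⟨v, hvΓ, hv, hmin⟩ := key _ le_rfl
  refine ⟨v, hvΓ, hv, ?_, ?_⟩
  · intro i j hij
    refine hmin (v j) (hvΓ j) i ?_
    have := hv.notMem_span_image (s := Set.Iio i) (x := j) (by simpa using hij)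
    exact this
  · intro x hx
    by_contra hx'
    -- minimality at the first `v i` longer than `x` puts `x` in the span of the preceding vectors
    have hne : {i | ℓ x < ℓ (v i)}.Nonempty := by
      by_contra h
      have hall : {j | ℓ (v j) ≤ ℓ x} = Set.univ := by
        ext j
        simpa using fun h' => h ⟨j, h'⟩
      have htop := hv.span_eq_top_of_card_eq_finrank' (by simp)
      rw [hall, Set.image_univ, htop] at hx'
      exact hx' Submodule.mem_top
    obtain ⟨i, hi, hleast⟩ := wellFounded_lt.has_min _ hne
    refine absurd (hmin x hx i fun h => hx' (Submodule.span_mono ?_ h)) (not_le.2 hi)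
    rintro _ ⟨j, hj, rfl⟩
    exact ⟨j, not_lt.1 fun h : ℓ x < ℓ (v j) => hleast j h hj, rfl⟩

theorem summable_prod_pi {ι α : Type*} [Fintype ι] {f : α → ℝ} (hf0 : ∀ a, 0 ≤ f a)
    (hf : Summable f) : Summable fun u : ι → α => ∏ i, f (u i) := by
  classical
  refine summable_of_sum_le (c := ∏ _i : ι, ∑' a, f a)
    (fun u => Finset.prod_nonneg fun i _ => hf0 _) fun s => ?_
  calc ∑ u ∈ s, ∏ i, f (u i)
      ≤ ∑ u ∈ Fintype.piFinset fun i => s.image fun u => u i, ∏ i, f (u i) := by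
        refine Finset.sum_le_sum_of_subset_of_nonneg (fun u hu => ?_)
          fun u _ _ => Finset.prod_nonneg fun i _ => hf0 _
        exact Fintype.mem_piFinset.2 fun i => Finset.mem_image_of_mem _ hu
    _ = ∏ i, ∑ a ∈ s.image fun u => u i, f a := (Finset.prod_univ_sum _ _).symm
    _ ≤ ∏ _i : ι, ∑' a, f a :=
        Finset.prod_le_prod (fun i _ => Finset.sum_nonneg fun a _ => hf0 a)
          fun i _ => hf.sum_le_tsum _ fun a _ => hf0 a

/-! ### Finiteness of the index and pivot columns -/

/-- A common integral denominator of the entries of `D` annihilates the finitely generated group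
`M_{1 × m}(𝓞 K) / integralRows D`, which is therefore finite. -/
theorem denominatorIndex_ne_zero {K : Type*} [Field K] [NumberField K] {m n : ℕ}
    (D : Matrix (Fin m) (Fin n) K) : denominatorIndex D ≠ 0 := by
  classical
  obtain ⟨q, hq0, hq⟩ := exists_integral_multiples ℤ ℚ (L := K)
    (Finset.univ.image fun p : Fin m × Fin n => D p.1 p.2)
  have hmem (C : Fin m → 𝓞 K) : q • C ∈ integralRows D := by
    intro j
    have hint (i : Fin m) : IsIntegral ℤ ((C i : K) * (q • D i j)) :=
      (C i).isIntegral_coe.mul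
        (hq _ (Finset.mem_image_of_mem (fun p : Fin m × Fin n => D p.1 p.2)
          (Finset.mem_univ (i, j))))
    have hsum : Matrix.vecMul (fun i => ((q • C) i : K)) D j =
        ∑ i, (C i : K) * (q • D i j) := by
      simp [Matrix.vecMul, dotProduct, mul_assoc, mul_left_comm]
    rw [hsum]
    exact ⟨⟨∑ i, (C i : K) * (q • D i j), IsIntegral.sum _ fun i _ => hint i⟩, rfl⟩
  have htors : Module.IsTorsion ℤ
      ((Fin m → 𝓞 K) ⧸ (AddSubgroup.toIntSubmodule (integralRows D))) := by
    intro x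
    obtain ⟨C, rfl⟩ := Submodule.mkQ_surjective _ x
    refine ⟨⟨q, mem_nonZeroDivisors_of_ne_zero hq0⟩, ?_⟩
    change q • Submodule.mkQ (AddSubgroup.toIntSubmodule (integralRows D)) C = 0
    rw [← map_smul, Submodule.mkQ_apply, Submodule.Quotient.mk_eq_zero]
    exact hmem C
  have : Finite ((Fin m → 𝓞 K) ⧸ (AddSubgroup.toIntSubmodule (integralRows D))) :=
    Module.finite_of_fg_torsion _ htors
  exact @AddSubgroup.index_ne_zero_of_finite _ _ (integralRows D) this

/-- The pivot columns of a reduced row echelon matrix of full row rank form the identity. -/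
theorem Matrix.IsReducedRowEchelon.exists_submatrix_eq_one {K : Type*} [Field K] {m n : ℕ}
    {D : Matrix (Fin m) (Fin n) K} (hD : D.IsReducedRowEchelon) (hrank : D.rank = m) :
    ∃ piv : Fin m → Fin n, D.submatrix id piv = 1 := by
  have hli : LinearIndependent K D.row := by
    rw [linearIndependent_iff_card_eq_finrank_span, Set.finrank, ← Matrix.rank_eq_finrank_span_row,
      hrank, Fintype.card_fin]
  choose piv hpiv using fun i : Fin m =>
    (Matrix.row_ne_zero_iff_exists_isLeadingEntry (A := D)).1 (hli.ne_zero i)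
  refine ⟨piv, ?_⟩
  ext i j
  rcases eq_or_ne i j with rfl | hij
  · simpa using hD.eq_one (hpiv i)
  · simpa [hij] using hD.eq_zero_of_ne_of_isLeadingEntry hij (hpiv j)

/-! ### The lattice of integral rows -/

-- Shortcut instances: `mixedSpace K` is an abbreviation for a product, and instance search does not
-- find these facts by itself below a function type.
open scoped Classical in
instance instMeasurableAddMixedSpace (K : Type*) [Field K] [NumberField K] :
    MeasurableAdd (mixedEmbedding.mixedSpace K) := inferInstance

open scoped Classical in
instance instBorelSpaceMixedSpace (K : Type*) [Field K] [NumberField K] :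
    BorelSpace (mixedEmbedding.mixedSpace K) := inferInstance

open scoped Classical in
instance instBorelSpaceRow (K : Type*) [Field K] [NumberField K] (m : ℕ) :
    BorelSpace (Fin m → mixedEmbedding.mixedSpace K) := Pi.borelSpace

open scoped Classical in
instance instIsAddHaarMeasureRow (K : Type*) [Field K] [NumberField K] (m : ℕ) :
    (Measure.pi fun _ : Fin m => unimodularMeasure K).IsAddHaarMeasure :=
  Measure.pi.isAddHaarMeasure _

theorem countable_ringOfIntegers (K : Type*) [Field K] [NumberField K] : Countable (𝓞 K) :=
  (Module.finBasis ℤ (𝓞 K)).equivFun.injective.countable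

/-- The embedding of `K ^ m` into `K_ℝ ^ m`, entry by entry. -/
noncomputable def rowEmbedding (K : Type*) [Field K]
    (m : ℕ) : (Fin m → K) →+ (Fin m → mixedEmbedding.mixedSpace K) :=
  (mixedEmbedding K).toAddMonoidHom.compLeft (Fin m)

theorem rowEmbedding_apply (K : Type*) [Field K] {m : ℕ} (v : Fin m → K) (i : Fin m) :
    rowEmbedding K m v i = mixedEmbedding K (v i) := rfl

theorem rowEmbedding_injective (K : Type*) [Field K] [NumberField K] (m : ℕ) :
    Function.Injective (rowEmbedding K m) := fun _ _ h =>
  funext fun i => mixedEmbedding_injective K (congrFun h i)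

/-- The real basis of `K_ℝ ^ m` formed by the integral basis of `K` in each entry. It is also a
`ℤ`-basis of the image of `(𝓞 K) ^ m`. -/
noncomputable def rowBasis (K : Type*) [Field K] [NumberField K] (m : ℕ) :
    Module.Basis (Σ _ : Fin m, Module.Free.ChooseBasisIndex ℤ (𝓞 K)) ℝ
      (Fin m → mixedEmbedding.mixedSpace K) :=
  Pi.basis fun _ => mixedEmbedding.latticeBasis K

/-- The embedding of `(𝓞 K) ^ m` into `K_ℝ ^ m`, entry by entry. -/
noncomputable def integralRowEmbedding (K : Type*) [Field K] (m : ℕ) :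
    (Fin m → 𝓞 K) →+ (Fin m → mixedEmbedding.mixedSpace K) :=
  (rowEmbedding K m).comp ((algebraMap (𝓞 K) K).toAddMonoidHom.compLeft (Fin m))

theorem integralRowEmbedding_apply (K : Type*) [Field K] {m : ℕ} (C : Fin m → 𝓞 K) :
    integralRowEmbedding K m C = rowEmbedding K m fun i => (C i : K) := rfl

theorem integralRowEmbedding_injective (K : Type*) [Field K] [NumberField K] (m : ℕ) :
    Function.Injective (integralRowEmbedding K m) := fun _ _ h =>
  funext fun i => RingOfIntegers.coe_injective (congrFun (rowEmbedding_injective K m h) i)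

theorem mem_span_rowBasis (K : Type*) [Field K] [NumberField K] {m : ℕ}
    {y : Fin m → mixedEmbedding.mixedSpace K} :
    y ∈ Submodule.span ℤ (Set.range (rowBasis K m)) ↔ y ∈ (integralRowEmbedding K m).range := by
  have h1 : y ∈ Submodule.span ℤ (Set.range (rowBasis K m)) ↔
      ∀ i, y i ∈ mixedEmbedding.integerLattice K := by
    simp only [← mixedEmbedding.mem_span_latticeBasis, Module.Basis.mem_span_iff_repr_mem]
    constructor
    · intro h i j
      simpa [rowBasis] using h ⟨i, j⟩
    · rintro h ⟨i, j⟩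
      simpa [rowBasis] using h i j
  rw [h1]
  constructor
  · intro h
    choose C hC using h
    exact ⟨C, funext hC⟩
  · rintro ⟨C, rfl⟩ i
    exact ⟨C i, rfl⟩

open scoped Classical in
theorem exists_isAddFundamentalDomain_integralRowEmbedding (K : Type*) [Field K]
    [NumberField K] (m : ℕ) :
    ∃ F : Set (Fin m → mixedEmbedding.mixedSpace K),
      IsAddFundamentalDomain (integralRowEmbedding K m).range F
        (Measure.pi fun _ => unimodularMeasure K) ∧
      Measure.pi (fun _ : Fin m => unimodularMeasure K) F ≠ ⊤ := by
  have h : (Submodule.span ℤ (Set.range (rowBasis K m))).toAddSubgroup =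
      (integralRowEmbedding K m).range := by
    ext y
    exact mem_span_rowBasis K
  refine ⟨ZSpan.fundamentalDomain (rowBasis K m), h ▸ ZSpan.isAddFundamentalDomain' _ _, ?_⟩
  exact (ZSpan.fundamentalDomain_isBounded _).measure_lt_top.ne

open scoped Classical in
/-- A set whose translates by `integralRows D` are disjoint has measure at most `𝔇(D)`, up to a
factor that depends only on `K` and `m`. -/
theorem exists_measure_le_denominatorIndex_mul (K : Type*) [Field K] [NumberField K]
    (m : ℕ) : ∃ V : ENNReal, V ≠ ⊤ ∧
    ∀ (n : ℕ) (D : Matrix (Fin m) (Fin n) K) (P : Set (Fin m → mixedEmbedding.mixedSpace K)),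
      MeasurableSet P →
      (∀ C ∈ integralRows D, C ≠ 0 → ∀ y ∈ P, integralRowEmbedding K m C + y ∉ P) →
      Measure.pi (fun _ : Fin m => unimodularMeasure K) P ≤ denominatorIndex D * V := by
  obtain ⟨F, hF, hFV⟩ := exists_isAddFundamentalDomain_integralRowEmbedding K m
  refine ⟨_, hFV, fun n D P hP hdisj => ?_⟩
  let e : (Fin m → 𝓞 K) ≃+ (integralRowEmbedding K m).range :=
    AddMonoidHom.ofInjective (integralRowEmbedding_injective K m)
  let H := (integralRows D).map e.toAddMonoidHom
  have hH : H.index = denominatorIndex D := AddSubgroup.index_map_equiv _ e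
  have : H.FiniteIndex := ⟨hH ▸ denominatorIndex_ne_zero D⟩
  have := countable_ringOfIntegers K
  have : Countable (integralRowEmbedding K m).range := e.symm.injective.countable
  rw [← hH]
  refine measure_le_index_mul_of_disjoint_vadd hF H hP.nullMeasurableSet ?_
  rintro _ ⟨C, hC, rfl⟩ h0
  rw [Set.disjoint_left]
  rintro _ ⟨y, hy, rfl⟩
  exact hdisj C hC (fun h => h0 (by rw [h, map_zero])) y hy

/-! ### Rows in Euclidean space -/

open scoped Classical in
/-- The basis `rowBasis`, transported to Euclidean space by `toEuclidean`. The choice of the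
inner product is irrelevant; one is needed for Gram-Schmidt. -/
noncomputable def euclideanRowBasis (K : Type*) [Field K] [NumberField K] (n : ℕ) :
    Module.Basis (Σ _ : Fin n, Module.Free.ChooseBasisIndex ℤ (𝓞 K)) ℝ
      (EuclideanSpace ℝ (Fin (Module.finrank ℝ (Fin n → mixedEmbedding.mixedSpace K)))) :=
  (rowBasis K n).map toEuclidean.toLinearEquiv

/-- The lattice of integral rows `(𝓞 K) ^ n` in Euclidean space. -/
noncomputable def euclideanRowLattice (K : Type*) [Field K] [NumberField K] (n : ℕ) : Submodule ℤ
    (EuclideanSpace ℝ (Fin (Module.finrank ℝ (Fin n → mixedEmbedding.mixedSpace K)))) :=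
  Submodule.span ℤ (Set.range (euclideanRowBasis K n))

instance instDiscreteTopologyEuclideanRowLattice (K : Type*) [Field K] [NumberField K] (n : ℕ) :
    DiscreteTopology (euclideanRowLattice K n) :=
  inferInstanceAs (DiscreteTopology (Submodule.span ℤ (Set.range (euclideanRowBasis K n))))

theorem finrank_row (K : Type*) [Field K] [NumberField K] (n : ℕ) :
    Module.finrank ℝ (Fin n → mixedEmbedding.mixedSpace K) = n * Module.finrank ℚ K := by
  rw [Module.finrank_eq_card_basis (rowBasis K n), Fintype.card_sigma, Finset.sum_const,
    Finset.card_univ, Fintype.card_fin, ← Module.finrank_eq_card_chooseBasisIndex,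
    RingOfIntegers.rank, smul_eq_mul]

theorem finrank_euclideanRowLattice (K : Type*) [Field K] [NumberField K] (n : ℕ) :
    Module.finrank ℤ (euclideanRowLattice K n) = n * Module.finrank ℚ K := by
  have : IsZLattice ℝ (euclideanRowLattice K n) :=
    inferInstanceAs (IsZLattice ℝ (Submodule.span ℤ (Set.range (euclideanRowBasis K n))))
  rw [ZLattice.rank ℝ, finrank_euclideanSpace_fin, finrank_row]

/-- A row over `K` as a vector of Euclidean space. -/
noncomputable def euclideanRow (K : Type*) [Field K] [NumberField K] {n : ℕ} (u : Fin n → K) :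
    EuclideanSpace ℝ (Fin (Module.finrank ℝ (Fin n → mixedEmbedding.mixedSpace K))) :=
  toEuclidean (rowEmbedding K n u)

theorem euclideanRow_injective (K : Type*) [Field K] [NumberField K] (n : ℕ) :
    Function.Injective (euclideanRow K (n := n)) :=
  toEuclidean.injective.comp (rowEmbedding_injective K n)

theorem euclideanRow_mem_lattice {K : Type*} [Field K] [NumberField K] {n : ℕ} {u : Fin n → K}
    (hu : ∀ j, u j ∈ (algebraMap (𝓞 K) K).range) : euclideanRow K u ∈ euclideanRowLattice K n := by
  have h1 : rowEmbedding K n u ∈ Submodule.span ℤ (Set.range (rowBasis K n)) := by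
    rw [mem_span_rowBasis]
    choose C hC using hu
    exact ⟨C, congrArg (rowEmbedding K n) (funext hC)⟩
  have h2 := Submodule.mem_map_of_mem
    (f := ((toEuclidean (E := Fin n → mixedEmbedding.mixedSpace K)).toLinearEquiv.restrictScalars
      ℤ).toLinearMap) h1
  rw [Submodule.map_span, ← Set.range_comp] at h2
  exact h2

/-- The map `y ↦ y D` from `K_ℝ ^ m` to `K_ℝ ^ n`, with Euclidean space as its target. -/
noncomputable def rowMap {K : Type*} [Field K] [NumberField K] {m n : ℕ}
    (D : Matrix (Fin m) (Fin n) K) : (Fin m → mixedEmbedding.mixedSpace K) →ₗ[ℝ]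
      EuclideanSpace ℝ (Fin (Module.finrank ℝ (Fin n → mixedEmbedding.mixedSpace K))) :=
  toEuclidean.toLinearEquiv.toLinearMap ∘ₗ
    (D.map (mixedEmbedding K)).vecMulLinear.restrictScalars ℝ

theorem rowMap_apply {K : Type*} [Field K] [NumberField K] {m n : ℕ}
    (D : Matrix (Fin m) (Fin n) K) (y : Fin m → mixedEmbedding.mixedSpace K) :
    rowMap D y = toEuclidean (Matrix.vecMul y (D.map (mixedEmbedding K))) := rfl

theorem rowMap_rowEmbedding {K : Type*} [Field K] [NumberField K] {m n : ℕ}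
    (D : Matrix (Fin m) (Fin n) K) (v : Fin m → K) :
    rowMap D (rowEmbedding K m v) = euclideanRow K (Matrix.vecMul v D) := by
  rw [rowMap_apply, euclideanRow]
  congr 1
  ext1 j
  rw [rowEmbedding_apply, RingHom.map_vecMul]
  rfl

theorem rowMap_injective {K : Type*} [Field K] [NumberField K] {m n : ℕ}
    {D : Matrix (Fin m) (Fin n) K} {piv : Fin m → Fin n} (hpiv : D.submatrix id piv = 1) :
    Function.Injective (rowMap D) := by
  intro y y' h
  have h1 := toEuclidean.injective h
  have h2 (y : Fin m → mixedEmbedding.mixedSpace K) (i : Fin m) :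
      Matrix.vecMul y (D.map (mixedEmbedding K)) (piv i) = y i := by
    have h3 : (D.map (mixedEmbedding K)).submatrix id piv = 1 := by
      rw [Matrix.submatrix_map, hpiv, Matrix.map_one _ (map_zero _) (map_one _)]
    calc Matrix.vecMul y (D.map (mixedEmbedding K)) (piv i)
        = Matrix.vecMul y ((D.map (mixedEmbedding K)).submatrix id piv) i := rfl
      _ = y i := by rw [h3, Matrix.vecMul_one]
  ext1 i
  rw [← h2 y, ← h2 y']
  exact congrFun h1 _

/-! ### Successive minima of the row space -/

theorem rowEmbedding_rat_smul (K : Type*) [Field K] [NumberField K] {m : ℕ} (q : ℚ)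
    (v : Fin m → K) : rowEmbedding K m (q • v) = (q : ℝ) • rowEmbedding K m v := by
  ext1 i
  rw [rowEmbedding_apply, Pi.smul_apply, Pi.smul_apply, rowEmbedding_apply, map_rat_smul,
    Rat.cast_smul_eq_qsmul]

/-- A `K`-basis `v` of `K ^ m` and a `ℚ`-basis `ω` of `K` give the real basis of `K_ℝ ^ m` formed by
the images of `ω j • v i`, ordered with `i = k.divNat` as the leading index. Independence over `ℝ`
follows by counting: their real span contains the image of `K ^ m`, which spans `K_ℝ ^ m`. -/
theorem exists_basis_of_linearIndependent {K : Type*} [Field K] [NumberField K] {m : ℕ}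
    {v : Fin m → Fin m → K} (hv : LinearIndependent K v) :
    ∃ b : Module.Basis (Fin (m * Module.finrank ℚ K)) ℝ (Fin m → mixedEmbedding.mixedSpace K),
      ∀ (s : Set (Fin m)), ∀ x ∈ Submodule.span K (v '' s),
        rowEmbedding K m x ∈ Submodule.span ℝ (b '' {k | k.divNat ∈ s}) := by
  let ω := Module.finBasis ℚ K
  let w : Fin (m * Module.finrank ℚ K) → Fin m → mixedEmbedding.mixedSpace K :=
    fun k => rowEmbedding K m (ω k.modNat • v k.divNat)
  have hw (s : Set (Fin m)) (x : Fin m → K) (hx : x ∈ Submodule.span K (v '' s)) :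
      rowEmbedding K m x ∈ Submodule.span ℝ (w '' {k | k.divNat ∈ s}) := by
    suffices ∀ a : K, rowEmbedding K m (a • x) ∈ Submodule.span ℝ (w '' {k | k.divNat ∈ s}) by
      simpa using this 1
    induction hx using Submodule.span_induction with
    | mem x hx =>
      obtain ⟨l, hl, rfl⟩ := hx
      intro a
      rw [← ω.sum_repr a, Finset.sum_smul, map_sum]
      refine Submodule.sum_mem _ fun j _ => ?_
      rw [smul_assoc, rowEmbedding_rat_smul]
      refine Submodule.smul_mem _ _ (Submodule.subset_span ⟨finProdFinEquiv (l, j), ?_, ?_⟩)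
      · have : (finProdFinEquiv.symm (finProdFinEquiv (l, j))).1 = l := by simp
        change (finProdFinEquiv (l, j)).divNat ∈ s
        rwa [show (finProdFinEquiv (l, j)).divNat = l from this]
      · have : finProdFinEquiv.symm (finProdFinEquiv (l, j)) = (l, j) := by simp
        have h1 : (finProdFinEquiv (l, j)).divNat = l := congrArg Prod.fst this
        have h2 : (finProdFinEquiv (l, j)).modNat = j := congrArg Prod.snd this
        simp only [w, h1, h2]
    | zero => simp
    | add x y _ _ hx hy =>
      intro a
      rw [smul_add, map_add]
      exact Submodule.add_mem _ (hx a) (hy a)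
    | smul c x _ hx =>
      intro a
      rw [smul_smul]
      exact hx _
  have htop : ⊤ ≤ Submodule.span ℝ (Set.range w) := by
    rw [← (rowBasis K m).span_eq, Submodule.span_le]
    rintro _ ⟨⟨i, j⟩, rfl⟩
    have h1 : rowBasis K m ⟨i, j⟩ = rowEmbedding K m (Pi.single i (integralBasis K j)) := by
      ext1 l
      rw [rowEmbedding_apply, rowBasis, Pi.basis_apply, mixedEmbedding.latticeBasis_apply]
      rcases eq_or_ne l i with rfl | h
      · simp
      · simp [h]
    rw [h1]
    have := hw Set.univ (Pi.single i (integralBasis K j)) (by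
      rw [Set.image_univ, hv.span_eq_top_of_card_eq_finrank' (by simp)]
      exact Submodule.mem_top)
    simpa using this
  have hli : LinearIndependent ℝ w :=
    linearIndependent_of_top_le_span_of_card_eq_finrank htop (by simp [finrank_row])
  exact ⟨Module.Basis.mk hli htop, by simpa using hw⟩

/-- The group `integralRows D` contains `𝔇(D)` times each standard basis vector. -/
theorem span_integralRows {K : Type*} [Field K] [NumberField K] {m n : ℕ}
    (D : Matrix (Fin m) (Fin n) K) :
    Submodule.span K ((fun (C : Fin m → 𝓞 K) i => (C i : K)) '' integralRows D) = ⊤ := by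
  rw [eq_top_iff, ← (Pi.basisFun K (Fin m)).span_eq, Submodule.span_le]
  rintro _ ⟨i, rfl⟩
  have h0 : (denominatorIndex D : K) ≠ 0 := Nat.cast_ne_zero.2 (denominatorIndex_ne_zero D)
  have h1 : denominatorIndex D • (Pi.single i 1 : Fin m → 𝓞 K) ∈ integralRows D :=
    AddSubgroup.nsmul_index_mem _ _
  have h2 := Submodule.smul_mem _ (denominatorIndex D : K)⁻¹
    (Submodule.subset_span (R := K) (Set.mem_image_of_mem (fun C i => (C i : K)) h1))
  convert! h2 using 1
  ext j
  rcases eq_or_ne j i with rfl | h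
  · simp [h0]
  · simp [h]

/-- A weak form of Minkowski's second theorem for the integral points of the row space of `D`, with
successive minima over `K` and a constant independent of `D`. -/
theorem exists_lattice_vectors_measure_le (K : Type*) [Field K] [NumberField K] (m n : ℕ) {R : ℝ}
    (hR : 0 ≤ R) : ∃ κ : ENNReal, κ ≠ ⊤ ∧
      ∀ (D : Matrix (Fin m) (Fin n) K) (piv : Fin m → Fin n), D.submatrix id piv = 1 →
        ∃ v : Fin m → Fin m → K, LinearIndependent K v ∧
          (∀ i, euclideanRow K (Matrix.vecMul (v i) D) ∈ euclideanRowLattice K n) ∧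
          (∀ i, 0 < ‖euclideanRow K (Matrix.vecMul (v i) D)‖) ∧
          Measure.pi (fun _ : Fin m => unimodularMeasure K) {y | ‖rowMap D y‖ ≤ R} *
            ENNReal.ofReal
              (∏ i, ‖euclideanRow K (Matrix.vecMul (v i) D)‖ ^ Module.finrank ℚ K) ≤
            κ * denominatorIndex D := by
  classical
  obtain ⟨V, hV, hpack⟩ := exists_measure_le_denominatorIndex_mul K m
  let N := m * Module.finrank ℚ K
  refine ⟨ENNReal.ofReal ((2 * R * √N) ^ N) * V, ENNReal.mul_ne_top ENNReal.ofReal_ne_top hV,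
    fun D piv hpiv => ?_⟩
  -- the length of the integral vector `x D`
  let ℓ : (Fin m → K) → ℝ := fun x => ‖rowMap D (rowEmbedding K m x)‖
  let Γ : Set (Fin m → K) := (fun (C : Fin m → 𝓞 K) i => (C i : K)) '' integralRows D
  have hinj : Function.Injective fun x => rowMap D (rowEmbedding K m x) :=
    (rowMap_injective hpiv).comp (rowEmbedding_injective K m)
  have hlat (x : Fin m → K) (hx : x ∈ Γ) :
      rowMap D (rowEmbedding K m x) ∈ euclideanRowLattice K n := by
    obtain ⟨C, hC, rfl⟩ := hx
    rw [rowMap_rowEmbedding]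
    exact euclideanRow_mem_lattice hC
  have hfin (r : ℝ) : {x ∈ Γ | ℓ x ≤ r}.Finite := by
    refine Set.Finite.of_finite_image ((ZSpan.setFinite_inter (euclideanRowBasis K n)
      (Metric.isBounded_closedBall (x := 0) (r := r))).subset ?_) hinj.injOn
    rintro _ ⟨x, ⟨hx, hxr⟩, rfl⟩
    exact ⟨mem_closedBall_zero_iff.2 hxr, hlat x hx⟩
  obtain ⟨v, hvΓ, hv, hmono, hmin⟩ := exists_linearIndependent_successive_min
    (Module.finrank_fin_fun K) Γ (span_integralRows D) ℓ hfin
  have hpos (i : Fin m) : 0 < ℓ (v i) := by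
    refine norm_pos_iff.2 fun h => hv.ne_zero i (hinj ?_)
    simpa using h
  obtain ⟨b, hb⟩ := exists_basis_of_linearIndependent hv
  obtain ⟨P, hP, hdisj, hbound⟩ := exists_packing_box
    (Measure.pi fun _ : Fin m => unimodularMeasure K) (rowMap D) (rowMap_injective hpiv) b
    (fun k => ℓ (v k.divNat)) (fun k => hpos _)
    (fun k l hkl => hmono (Nat.div_le_div_right hkl)) hR
  have hprod : ∏ k : Fin (m * Module.finrank ℚ K), ℓ (v k.divNat) =
      ∏ i, ℓ (v i) ^ Module.finrank ℚ K := by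
    rw [← finProdFinEquiv.prod_comp, Fintype.prod_prod_type]
    refine Finset.prod_congr rfl fun i _ => ?_
    have (j : Fin (Module.finrank ℚ K)) : (finProdFinEquiv (i, j)).divNat = i :=
      congrArg Prod.fst (finProdFinEquiv.symm_apply_apply (i, j))
    simp [this]
  have hvec (i : Fin m) : euclideanRow K (Matrix.vecMul (v i) D) =
      rowMap D (rowEmbedding K m (v i)) := (rowMap_rowEmbedding D (v i)).symm
  refine ⟨v, hv, fun i => hvec i ▸ hlat _ (hvΓ i), fun i => hvec i ▸ hpos i, ?_⟩
  simp only [hvec]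
  rw [hprod] at hbound
  refine hbound.trans ?_
  rw [mul_assoc (ENNReal.ofReal _), mul_comm V]
  gcongr
  refine hpack n D P hP fun C hC hC0 y hy => hdisj _ ?_ ?_ y hy
  · exact fun h => hC0 (integralRowEmbedding_injective K m (by simpa using h))
  · rw [integralRowEmbedding_apply]
    exact hb {j | ℓ (v j) ≤ ℓ fun i => (C i : K)} _ (hmin _ ⟨C, hC, rfl⟩)

/-! ### Convergence of the series -/

/-- The pivot columns of `A * D` are the matrix `A`, so `A * D` and the position of the pivots
determine `D`. -/
theorem matrix_eq_of_mul_eq {K : Type*} [Field K] {m n : ℕ} {D D' : Matrix (Fin m) (Fin n) K}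
    {piv : Fin m → Fin n} (hD : D.submatrix id piv = 1) (hD' : D'.submatrix id piv = 1)
    {A A' : Matrix (Fin m) (Fin m) K} (hA : LinearIndependent K A.row) (h : A * D = A' * D') :
    D = D' := by
  have hAA : A = A' := by
    have h1 := congrArg (fun M => M.submatrix id piv) h
    simpa [Matrix.submatrix_mul _ _ id id piv Function.bijective_id, hD, hD'] using h1
  subst hAA
  have hu : IsUnit A := Matrix.linearIndependent_rows_iff_isUnit.1 hA
  have h1 := congrArg (fun M => A⁻¹ * M) h
  simpa [← Matrix.mul_assoc, Matrix.nonsing_inv_mul _ ((Matrix.isUnit_iff_isUnit_det A).1 hu)]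
    using h1

open scoped Classical in
theorem isClosed_preimage_mul {K : Type*} [Field K] [NumberField K] {t m n : ℕ}
    {S : Set (Matrix (Fin t) (Fin n) (mixedEmbedding.mixedSpace K))} (hS : IsClosed S)
    (D : Matrix (Fin m) (Fin n) K) :
    IsClosed {x : Fin t → Fin m → mixedEmbedding.mixedSpace K |
      Matrix.of x * D.map (mixedEmbedding K) ∈ S} := by
  refine hS.preimage ?_
  refine continuous_pi fun i => continuous_pi fun j => ?_
  simp only [Matrix.mul_apply, Matrix.of_apply]
  fun_prop

theorem matrixMeasure_preimage_mul_le {K : Type*} [Field K] [NumberField K] {t m n : ℕ}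
    {S : Set (Matrix (Fin t) (Fin n) (mixedEmbedding.mixedSpace K))} {R : ℝ}
    (hR : ∀ s ∈ S, ∀ i, ‖toEuclidean (s i)‖ ≤ R) (D : Matrix (Fin m) (Fin n) K) :
    matrixMeasure K t m {x | Matrix.of x * D.map (mixedEmbedding K) ∈ S} ≤
      Measure.pi (fun _ : Fin m => unimodularMeasure K) {y | ‖rowMap D y‖ ≤ R} ^ t := by
  have : SigmaFinite (unimodularMeasure K) := inferInstance
  have : SigmaFinite (Measure.pi fun _ : Fin m => unimodularMeasure K) := inferInstance
  calc matrixMeasure K t m {x | Matrix.of x * D.map (mixedEmbedding K) ∈ S}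
      ≤ matrixMeasure K t m (Set.univ.pi fun _ => {y | ‖rowMap D y‖ ≤ R}) := by
        refine measure_mono fun x hx i _ => ?_
        have := hR _ hx i
        rwa [Matrix.mul_apply_eq_vecMul] at this
    _ = _ := by
        rw [matrixMeasure, Measure.pi_pi, Finset.prod_const, Finset.card_univ, Fintype.card_fin]

/-- The term of `D` is bounded by a product over a `K`-basis of the row space of `D` that consists
of integral vectors, with a constant independent of `D`. -/
theorem exists_momentTerm_le (K : Type*) [Field K] [NumberField K] {t n : ℕ} (m : ℕ)
    {S : Set (Matrix (Fin t) (Fin n) (mixedEmbedding.mixedSpace K))} (hS : IsCompact S) :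
    ∃ κ : ℝ, ∀ (D : Matrix (Fin m) (Fin n) K) (piv : Fin m → Fin n), D.submatrix id piv = 1 →
      Integrable (pullbackAlong (S.indicator fun _ => (1 : ℝ)) D) (matrixMeasure K t m) ∧
      ∃ v : Fin m → Fin m → K, LinearIndependent K v ∧
        (∀ i, euclideanRow K (Matrix.vecMul (v i) D) ∈ euclideanRowLattice K n) ∧
        momentTerm (S.indicator fun _ => (1 : ℝ)) D ≤
          κ * ∏ i, ‖euclideanRow K (Matrix.vecMul (v i) D)‖⁻¹ ^ (Module.finrank ℚ K * t) := by
  obtain ⟨R, hR⟩ := hS.exists_bound_of_continuousOn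
    (f := fun s : Matrix (Fin t) (Fin n) (mixedEmbedding.mixedSpace K) =>
      fun i => toEuclidean (s i))
    (continuous_pi fun i => toEuclidean.continuous.comp (continuous_apply i)).continuousOn
  have hR' : ∀ s ∈ S, ∀ i, ‖toEuclidean (s i)‖ ≤ max R 0 := fun s hs i =>
    (norm_le_pi_norm (fun i => toEuclidean (s i)) i).trans ((hR s hs).trans (le_max_left _ _))
  obtain ⟨κ, hκ, h⟩ := exists_lattice_vectors_measure_le K m n (le_max_right R 0)
  refine ⟨κ.toReal ^ t, fun D piv hpiv => ?_⟩
  obtain ⟨v, hv, hlat, hpos, hle⟩ := h D piv hpiv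
  set A := Measure.pi (fun _ : Fin m => unimodularMeasure K) {y | ‖rowMap D y‖ ≤ max R 0}
  set T : Set (Fin t → Fin m → mixedEmbedding.mixedSpace K) :=
    {x | Matrix.of x * D.map (mixedEmbedding K) ∈ S}
  set p := ∏ i, ‖euclideanRow K (Matrix.vecMul (v i) D)‖ ^ Module.finrank ℚ K with hp
  have hp0 : 0 < p := Finset.prod_pos fun i _ => pow_pos (hpos i) _
  have hD0 : (0 : ℝ) < denominatorIndex D :=
    Nat.cast_pos.2 (Nat.pos_of_ne_zero (denominatorIndex_ne_zero D))
  have hrhs : κ * denominatorIndex D ≠ ⊤ := ENNReal.mul_ne_top hκ (ENNReal.natCast_ne_top _)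
  -- the estimate itself shows that the ball has finite volume, as `0 < p`
  have hA : A ≠ ⊤ := by
    intro hA
    rw [hA, ENNReal.top_mul (by simpa using hp0)] at hle
    exact hrhs (top_le_iff.1 hle)
  have hA' : A.toReal * p ≤ κ.toReal * denominatorIndex D := by
    have := ENNReal.toReal_mono hrhs hle
    rwa [ENNReal.toReal_mul, ENNReal.toReal_mul, ENNReal.toReal_ofReal hp0.le,
      ENNReal.toReal_natCast] at this
  have hT : matrixMeasure K t m T ≤ A ^ t := matrixMeasure_preimage_mul_le hR' D
  have hTm : MeasurableSet T := (isClosed_preimage_mul hS.isClosed D).measurableSet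
  have hTtop : matrixMeasure K t m T ≠ ⊤ := ne_top_of_le_ne_top (ENNReal.pow_ne_top hA) hT
  have hpull : pullbackAlong (S.indicator fun _ => (1 : ℝ)) D = T.indicator fun _ => 1 := rfl
  refine ⟨?_, v, hv, hlat, ?_⟩
  · rw [hpull, integrable_indicator_iff hTm]
    exact integrableOn_const hTtop
  · have hint : ∫ x, pullbackAlong (S.indicator fun _ => (1 : ℝ)) D x ∂(matrixMeasure K t m) ≤
        A.toReal ^ t := by
      rw [hpull, integral_indicator_const _ hTm, smul_eq_mul, mul_one, measureReal_def,
        ← ENNReal.toReal_pow]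
      exact ENNReal.toReal_mono (ENNReal.pow_ne_top hA) hT
    have hquot : A.toReal / denominatorIndex D ≤ κ.toReal * p⁻¹ := by
      rw [div_le_iff₀ hD0, mul_right_comm, ← div_eq_mul_inv, le_div_iff₀ hp0]
      exact hA'
    calc momentTerm (S.indicator fun _ => (1 : ℝ)) D
        ≤ ((denominatorIndex D : ℝ) ^ t)⁻¹ * A.toReal ^ t := by
          rw [momentTerm]; gcongr
      _ = (A.toReal / denominatorIndex D) ^ t := by rw [div_pow, div_eq_inv_mul]
      _ ≤ (κ.toReal * p⁻¹) ^ t := by gcongr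
      _ = _ := by
          rw [mul_pow, hp, ← Finset.prod_inv_distrib, ← Finset.prod_pow]
          simp only [pow_mul, inv_pow]

theorem momentTerm_indicator_nonneg {K : Type*} [Field K] [NumberField K] {t m n : ℕ}
    (S : Set (Matrix (Fin t) (Fin n) (mixedEmbedding.mixedSpace K)))
    (D : Matrix (Fin m) (Fin n) K) : 0 ≤ momentTerm (S.indicator fun _ => (1 : ℝ)) D :=
  mul_nonneg (by positivity)
    (integral_nonneg fun _ => Set.indicator_nonneg (fun _ _ => zero_le_one) _)

/-- For a fixed rank `m`, the series over `D` is dominated by one over pairs of a choice of pivot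
columns and an `m`-tuple of integral vectors. -/
theorem summable_momentTerm (K : Type*) [Field K] [NumberField K] {n t : ℕ} (ht : n + 1 ≤ t)
    (m : ℕ) {S : Set (Matrix (Fin t) (Fin n) (mixedEmbedding.mixedSpace K))} (hS : IsCompact S) :
    Summable fun D : FullRankEchelon K m n =>
      momentTerm (S.indicator fun _ => (1 : ℝ)) D.1 := by
  obtain ⟨κ, hκ⟩ := exists_momentTerm_le K m hS
  choose piv hpiv using fun D : FullRankEchelon K m n => D.2.1.exists_submatrix_eq_one D.2.2
  choose v hv hlat hle using fun D : FullRankEchelon K m n => (hκ D.1 (piv D) (hpiv D)).2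
  -- `Φ` is injective: the pivot columns and the vectors `v i D` determine `D`
  let Φ : FullRankEchelon K m n → (Fin m → Fin n) × (Fin m → euclideanRowLattice K n) :=
    fun D => (piv D, fun i => ⟨_, hlat D i⟩)
  have hΦ : Function.Injective Φ := by
    intro D D' h
    have h1 : piv D = piv D' := congrArg Prod.fst h
    refine Subtype.ext (matrix_eq_of_mul_eq (hpiv D) (h1 ▸ hpiv D') (A := Matrix.of (v D))
      (A' := Matrix.of (v D')) (hv D) ?_)
    refine funext fun i => ?_
    rw [Matrix.mul_apply_eq_vecMul, Matrix.mul_apply_eq_vecMul]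
    exact euclideanRow_injective K n
      (congrArg Subtype.val (congrFun (congrArg Prod.snd h) i))
  have hrank : Module.finrank ℤ (euclideanRowLattice K n) < Module.finrank ℚ K * t := by
    rw [finrank_euclideanRowLattice, mul_comm]
    exact Nat.mul_lt_mul_of_pos_left ht Module.finrank_pos
  have hsum := summable_prod_pi (ι := Fin m) (fun z : euclideanRowLattice K n => by positivity)
    (ZLattice.summable_norm_pow_inv (euclideanRowLattice K n) _ hrank)
  have hsum' : Summable fun q : (Fin m → Fin n) × (Fin m → euclideanRowLattice K n) =>
      ∏ i, ‖q.2 i‖⁻¹ ^ (Module.finrank ℚ K * t) := by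
    rw [summable_prod_of_nonneg fun q => Finset.prod_nonneg fun i _ => by positivity]
    exact ⟨fun _ => hsum, Summable.of_finite⟩
  exact Summable.of_nonneg_of_le (fun D => momentTerm_indicator_nonneg S D.1) hle
    ((hsum'.comp_injective hΦ).mul_left κ)

/-- The right-hand side of the higher moment formula converges for `t ≥ n + 1`: all indices `𝔇(D)`
are finite, all the integrals exist, and the series over all `m ∈ {0, …, n}` and all reduced row
echelon matrices `D ∈ M_{m × n}(K)` of rank `m` converges (its terms are non-negative). -/
theorem mainTheorem12 (K : Type*) [Field K] [NumberField K] (n t : ℕ) (ht : n + 1 ≤ t)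
    (S : Set (Matrix (Fin t) (Fin n) (NumberField.mixedEmbedding.mixedSpace K)))
    (hconv : Convex ℝ S) (hcomp : IsCompact S) :
    (∀ m : Fin (n + 1), ∀ D : FullRankEchelon K m n,
      denominatorIndex D.1 ≠ 0 ∧
      MeasureTheory.Integrable (pullbackAlong (S.indicator fun _ => (1 : ℝ)) D.1)
        (matrixMeasure K t m)) ∧
    Summable fun p : (Σ m : Fin (n + 1), FullRankEchelon K m n) =>
      momentTerm (S.indicator fun _ => (1 : ℝ)) p.2.1 := by
  refine ⟨fun m D => ⟨denominatorIndex_ne_zero D.1, ?_⟩, ?_⟩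
  · obtain ⟨κ, hκ⟩ := exists_momentTerm_le K m hcomp
    obtain ⟨piv, hpiv⟩ := D.2.1.exists_submatrix_eq_one D.2.2
    exact (hκ D.1 piv hpiv).1
  · have hnonneg (p : Σ m : Fin (n + 1), FullRankEchelon K m n) :
        0 ≤ momentTerm (S.indicator fun _ => (1 : ℝ)) p.2.1 :=
      momentTerm_indicator_nonneg S p.2.1
    refine (summable_sigma_of_nonneg hnonneg).2 ⟨?_, ?_⟩
    · intro m
      exact summable_momentTerm K ht (m : ℕ) hcomp
    · exact (hasSum_fintype _).summable
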